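/- Proposition 3.7 (mean transforms). For a bounded sequence $\alpha=(\alpha_n)_{n\ge 0}$ of positive reals let $W_\alpha$ be the weighted shift on $\ell^2$ (with standard basis $(e_n)_{n\ge0}$), $W_\alpha e_n=\alpha_n e_{n+1}$. A bounded operator $T$ on a Hilbert space is subnormal if it is unitarily equivalent to the restriction of a normal operator to a closed invariant subspace. The shift $W_\alpha$ is moment infinitely divisible (MID) if for every $s>0$ the shift with weights $(\alpha_n^s)_{n\ge 0}$ is subnormal. A real sequence $\psi$ is completely alternating if $(\nabla^k\psi)(n)\le 0$ for all $k\ge1$, $n\ge0$, where $(\nabla\psi)(n)=\psi(n)-\psi(n+1)$. For an operator $T$ with polar decomposition $T=U|T|$ and $0\le t\le \frac12$, the generalized mean transform of $T$ is $\widehat T(t)=\frac12\left(|T|^tU|T|^{1-t}+|T|^{1-t}U|T|^{t}\right)$, with $|T|^0=I$. Suppose that $W_\alpha$ is a contraction, i.e. $\|W_\alpha\|\le 1$. (1) If $(\alpha_n^2)_{n\ge0}$ is completely alternating, then the weighted shift with weights $\sqrt{(\alpha_n^2+\alpha_{n+1}^2)/2}$ $(n\ge 0)$ and, for every $t\in[0,\frac12]$,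 the generalized mean transform $\widehat{W_\alpha}(t)$ are weighted shifts (with bounded positive weights) that are contractive and MID, hence subnormal. (2) If $(\alpha_n)_{n\ge0}$ is completely alternating, then for every $t\in[0,\frac12]$ the generalized mean transform $\widehat{W_\alpha}(t)$ is a weighted shift (with bounded positive weights) that is contractive and MID, hence subnormal. -/

import Mathlib

universe u

noncomputable section

/-! ### Differences of real sequences -/

/-- The difference operator `(∇φ)(n) = φ(n) - φ(n+1)` on real sequences. -/
def nabla (φ : ℕ → ℝ) : ℕ → ℝ := fun n => φ n - φ (n + 1)

/-- A real sequence `ψ` is completely alternating if `(∇^k ψ)(n) ≤ 0` for all `k ≥ 1`, `n ≥ 0`. -/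
def IsCompletelyAlternating (ψ : ℕ → ℝ) : Prop :=
  ∀ k : ℕ, 1 ≤ k → ∀ n : ℕ, (nabla^[k] ψ) n ≤ 0

/-! ### Subnormal operators -/

/-- A bounded operator on a Hilbert space is subnormal if it is unitarily equivalent to the
restriction of a normal operator `N` to a closed invariant subspace (the range of the linear
isometry `V`). -/
def IsSubnormal {H : Type u} [NormedAddCommGroup H] [InnerProductSpace ℂ H] [CompleteSpace H]
    (T : H →L[ℂ] H) : Prop :=
  ∃ (K : Type u) (_ : NormedAddCommGroup K) (_ : InnerProductSpace ℂ K) (_ : CompleteSpace K)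
    (V : H →ₗᵢ[ℂ] K) (N : K →L[ℂ] K), IsStarNormal N ∧ ∀ x : H, N (V x) = V (T x)

/-! ### Polar decomposition and the generalized mean transform -/

section Polar

variable {H : Type*} [NormedAddCommGroup H] [InnerProductSpace ℂ H] [CompleteSpace H]

/-- `T = U |T|` is the polar decomposition of `T`: here `|T| = (T^* T)^{1/2}`, and `U` is a partial
isometry (it is isometric on the orthogonal complement of its kernel) with `ker U = ker T`. -/
structure IsPolarPart (T U : H →L[ℂ] H) : Prop where
  eq_mul_abs : T = U * CFC.abs T
  norm_apply : ∀ x ∈ (LinearMap.ker U.toLinearMap)ᗮ, ‖U x‖ = ‖x‖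
  ker_eq : LinearMap.ker U.toLinearMap = LinearMap.ker T.toLinearMap

theorem norm_abs_apply (T : H →L[ℂ] H) (x : H) : ‖CFC.abs T x‖ = ‖T x‖ := by
  have hsa : IsSelfAdjoint (CFC.abs T) := IsSelfAdjoint.of_nonneg (CFC.abs_nonneg T)
  have h : star (CFC.abs T) * CFC.abs T = star T * T := by
    rw [hsa.star_eq, CFC.abs_mul_abs]
  have h1 : ∀ S : H →L[ℂ] H, inner ℂ ((star S * S) x) x = ((‖S x‖ : ℂ)) ^ 2 := by
    intro S
    rw [ContinuousLinearMap.star_eq_adjoint, mul_apply_eq_comp,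
      ContinuousLinearMap.adjoint_inner_left]
    exact inner_self_eq_norm_sq_to_K (S x)
  have h2 : ((‖CFC.abs T x‖ : ℂ)) ^ 2 = ((‖T x‖ : ℂ)) ^ 2 := by rw [← h1, ← h1, h]
  have h3 : ‖CFC.abs T x‖ ^ 2 = ‖T x‖ ^ 2 := by exact_mod_cast h2
  exact (sq_eq_sq₀ (norm_nonneg _) (norm_nonneg _)).1 h3

theorem ker_abs (T : H →L[ℂ] H) :
    LinearMap.ker (CFC.abs T).toLinearMap = LinearMap.ker T.toLinearMap := by
  ext x
  have h := norm_abs_apply T x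
  simp only [LinearMap.mem_ker, ContinuousLinearMap.coe_coe]
  rw [← norm_eq_zero, h, norm_eq_zero]

theorem orthogonal_closure_range_abs (T : H →L[ℂ] H) :
    ((LinearMap.range (CFC.abs T).toLinearMap).topologicalClosure)ᗮ
      = LinearMap.ker T.toLinearMap := by
  have hsa : IsSelfAdjoint (CFC.abs T) := IsSelfAdjoint.of_nonneg (CFC.abs_nonneg T)
  rw [Submodule.orthogonal_closure, ← ker_abs]
  have := ContinuousLinearMap.orthogonal_range (CFC.abs T)
  rw [this, ← ContinuousLinearMap.star_eq_adjoint, hsa.star_eq]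

/-- Every bounded operator has a unique polar decomposition. -/
theorem existsUnique_isPolarPart (T : H →L[ℂ] H) : ∃! U : H →L[ℂ] H, IsPolarPart T U := by
  set S := (LinearMap.range (CFC.abs T).toLinearMap).topologicalClosure with hS
  have hSo : Sᗮ = LinearMap.ker T.toLinearMap := orthogonal_closure_range_abs T
  have hSc : IsClosed (S : Set H) := Submodule.isClosed_topologicalClosure _
  have : CompleteSpace S := hSc.completeSpace_coe
  have hmem : ∀ x, (CFC.abs T).toLinearMap x ∈ S := fun x =>
    Submodule.le_topologicalClosure _ (LinearMap.mem_range_self _ x)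
  let e : H →ₗ[ℂ] S := (CFC.abs T).toLinearMap.codRestrict S hmem
  have he : ∀ x, ((e x : S) : H) = CFC.abs T x := fun x => rfl
  have hdense : DenseRange e := by
    intro y
    rw [closure_subtype]
    have hy : (y : H) ∈ closure ((LinearMap.range (CFC.abs T).toLinearMap : Submodule ℂ H) : Set H) :=
      y.2
    refine closure_mono ?_ hy
    rintro _ ⟨x, rfl⟩
    exact ⟨e x, ⟨x, rfl⟩, rfl⟩
  have hnorm : ∀ x, ‖T.toLinearMap x‖ ≤ 1 * ‖e x‖ := by
    intro x
    rw [one_mul]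
    change ‖T x‖ ≤ ‖CFC.abs T x‖
    rw [norm_abs_apply]
  let g : S →L[ℂ] H := T.toLinearMap.extendOfNorm e
  have hg : ∀ x, g (e x) = T x := fun x =>
    LinearMap.extendOfNorm_eq hdense ⟨1, hnorm⟩ x
  have hgn : ∀ y, ‖g y‖ = ‖y‖ := by
    refine fun y => hdense.induction_on y ?_ ?_
    · exact isClosed_eq (by fun_prop) (by fun_prop)
    · intro x
      rw [hg]
      change ‖T x‖ = ‖CFC.abs T x‖
      rw [norm_abs_apply]
  let U : H →L[ℂ] H := g ∘L S.orthogonalProjectionOnto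
  have hUS : ∀ y : S, U y = g y := by
    intro y
    change g (S.orthogonalProjectionOnto y) = g y
    rw [Submodule.orthogonalProjectionOnto_mem_subspace_eq_self]
  have hker : LinearMap.ker U.toLinearMap = LinearMap.ker T.toLinearMap := by
    rw [← hSo]
    ext x
    rw [LinearMap.mem_ker, ← Submodule.orthogonalProjectionOnto_eq_zero_iff (K := S)]
    change g (S.orthogonalProjectionOnto x) = 0 ↔ _
    rw [← norm_eq_zero, hgn, norm_eq_zero]
  refine ⟨U, ⟨?_, ?_, hker⟩, ?_⟩
  · ext x
    rw [mul_apply_eq_comp, ← he, hUS, hg]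
  · intro x hx
    rw [hker, ← hSo, Submodule.orthogonal_orthogonal] at hx
    have := hUS ⟨x, hx⟩
    change U x = _ at this
    rw [this, hgn]
    rfl
  · intro U' hU'
    have hUe : ∀ x, U' (e x) = g (e x) := by
      intro x
      rw [hg, he]
      conv_rhs => rw [hU'.eq_mul_abs]
      rfl
    have hUg : ∀ y : S, U' y = g y := by
      refine fun y => hdense.induction_on y ?_ hUe
      exact isClosed_eq (by fun_prop) (by fun_prop)
    ext x
    have hx := Submodule.sub_starProjection_mem_orthogonal (K := S) x
    rw [hSo, ← hU'.ker_eq, LinearMap.mem_ker] at hx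
    change U' (x - S.orthogonalProjectionOnto x) = 0 at hx
    rw [map_sub, sub_eq_zero] at hx
    rw [hx, hUg]
    rfl

/-- The partial isometry `U` in the polar decomposition `T = U |T|`. -/
def polarPart (T : H →L[ℂ] H) : H →L[ℂ] H :=
  Classical.choose (existsUnique_isPolarPart T).exists

theorem isPolarPart_polarPart (T : H →L[ℂ] H) : IsPolarPart T (polarPart T) :=
  Classical.choose_spec (existsUnique_isPolarPart T).exists

/-- The generalized Aluthge transform `|T|^t U |T|^{1-t}` (with the convention `|T|^0 = 1`). -/
def generalizedAluthge (T : H →L[ℂ] H) (t : ℝ) : H →L[ℂ] H :=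
  (CFC.abs T) ^ t * polarPart T * (CFC.abs T) ^ (1 - t)

/-- The generalized mean transform: the average of the generalized Aluthge transforms with
parameters `t` and `1 - t`. -/
def generalizedMeanTransform (T : H →L[ℂ] H) (t : ℝ) : H →L[ℂ] H :=
  (1 / 2 : ℂ) • (generalizedAluthge T t + generalizedAluthge T (1 - t))

end Polar

/-! ### Unilateral weighted shifts -/

/-- The Hilbert space `ℓ²` of square-summable complex sequences. -/
abbrev EllTwo : Type := lp (fun _ : ℕ => ℂ) 2

/-- Boundedness of a weight sequence. -/
def IsBoundedSeq (α : ℕ → ℝ) : Prop := ∃ C : ℝ, ∀ n, |α n| ≤ C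

/-- The sequence `(0, α₀ x₀, α₁ x₁, …)`. -/
def shiftSeq (α : ℕ → ℝ) (x : ℕ → ℂ) : ℕ → ℂ
  | 0 => 0
  | n + 1 => (α n : ℂ) * x n

theorem hasSum_norm_sq (x : EllTwo) : HasSum (fun n => ‖x n‖ ^ 2) (‖x‖ ^ 2) := by
  have h := lp.hasSum_norm (p := 2) (by norm_num) x
  simpa using h

theorem shiftSeq_summable_le {α : ℕ → ℝ} {C : ℝ} (hC : ∀ n, |α n| ≤ C) (x : EllTwo) :
    ∃ s : ℝ, HasSum (fun n => ‖shiftSeq α x n‖ ^ 2) s ∧ s ≤ C ^ 2 * ‖x‖ ^ 2 := by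
  have hx := (hasSum_norm_sq x).mul_left (C ^ 2)
  have hle : ∀ n, ‖shiftSeq α x (n + 1)‖ ^ 2 ≤ C ^ 2 * ‖x n‖ ^ 2 := by
    intro n
    simp only [shiftSeq, norm_mul, Complex.norm_real, Real.norm_eq_abs, mul_pow]
    gcongr
    exact hC n
  have hs : Summable (fun n => ‖shiftSeq α x (n + 1)‖ ^ 2) :=
    Summable.of_nonneg_of_le (fun _ => by positivity) hle hx.summable
  refine ⟨_, ((hasSum_nat_add_iff (f := fun n => ‖shiftSeq α x n‖ ^ 2) 1).1 hs.hasSum), ?_⟩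
  simpa [shiftSeq] using hasSum_le hle hs.hasSum hx

theorem memℓp_shiftSeq {α : ℕ → ℝ} (hα : IsBoundedSeq α) (x : EllTwo) :
    Memℓp (E := fun _ : ℕ => ℂ) (shiftSeq α x) 2 := by
  obtain ⟨C, hC⟩ := hα
  obtain ⟨s, hs, -⟩ := shiftSeq_summable_le hC x
  exact memℓp_gen (by simpa using hs.summable)

/-- The weighted shift `W_α` on `ℓ²` as a linear map. -/
def weightedShiftLin (α : ℕ → ℝ) (hα : IsBoundedSeq α) : EllTwo →ₗ[ℂ] EllTwo where
  toFun x := ⟨shiftSeq α x, memℓp_shiftSeq hα x⟩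
  map_add' x y := by
    ext n
    change shiftSeq α (⇑x + ⇑y) n = shiftSeq α x n + shiftSeq α y n
    cases n <;> simp [shiftSeq, mul_add]
  map_smul' c x := by
    ext n
    change shiftSeq α (c • ⇑x) n = c * shiftSeq α x n
    cases n <;> simp [shiftSeq, mul_left_comm]

/-- The weighted shift `W_α`, a bounded operator on `ℓ²`, with bounded weight sequence `α`:
`W_α (x₀, x₁, …) = (0, α₀ x₀, α₁ x₁, …)`, i.e. `W_α e_n = α_n e_{n+1}`. -/
def weightedShift (α : ℕ → ℝ) (hα : IsBoundedSeq α) : EllTwo →L[ℂ] EllTwo :=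
  (weightedShiftLin α hα).mkContinuousOfExistsBound <| by
    obtain ⟨C, hC⟩ := id hα
    refine ⟨C, fun x => ?_⟩
    obtain ⟨s, hs, hle⟩ := shiftSeq_summable_le hC x
    have h := (hasSum_norm_sq (weightedShiftLin α hα x)).unique hs
    have hC0 : 0 ≤ C := (abs_nonneg _).trans (hC 0)
    rw [← h, ← mul_pow] at hle
    exact (sq_le_sq₀ (norm_nonneg _) (by positivity)).1 hle

theorem weightedShift_single (α : ℕ → ℝ) (hα : IsBoundedSeq α) (n : ℕ) :
    weightedShift α hα (lp.single 2 n 1) = (α n : ℂ) • lp.single 2 (n + 1) 1 := by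
  ext m
  change shiftSeq α (lp.single (E := fun _ : ℕ => ℂ) 2 n 1) m
    = (α n : ℂ) * lp.single (E := fun _ : ℕ => ℂ) 2 (n + 1) 1 m
  cases m with
  | zero => simp [shiftSeq]
  | succ m =>
    by_cases h : m = n
    · subst h; simp [shiftSeq]
    · simp [shiftSeq, h]

/-- An operator on `ℓ²` is a moment infinitely divisible (MID) weighted shift if it is `W_α` for
some bounded positive weight sequence `α` such that for every `s > 0` the shift with weights
`α₀^s, α₁^s, …` is subnormal. -/
def IsMID (T : EllTwo →L[ℂ] EllTwo) : Prop :=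
  ∃ (α : ℕ → ℝ) (hα : IsBoundedSeq α), (∀ n, 0 < α n) ∧ T = weightedShift α hα ∧
    ∀ s : ℝ, 0 < s →
      ∃ hs : IsBoundedSeq (fun n => α n ^ s), IsSubnormal (weightedShift (fun n => α n ^ s) hs)

end

section

open Finset Filter Topology MeasureTheory
open scoped ComplexOrder

/-! Everything reduces to one class of weights: positive `w` with `1 - w` completely monotone.
Contractivity gives `α n ≤ 1`, the order-zero condition, and complete alternation gives the higher
orders.

For such `w` the products `γ n = ∏ i < n, w i` satisfy `∇γ = γ (1 - w)`, so the Leibniz rule makes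
`γ` completely monotone. The class is stable under averages, shifts and powers `θ ∈ [0, 1]`, the
latter because `1 - (1 - u)^θ` is a power series in `u` with nonnegative coefficients. Hence the
products of `w i ^ s` are completely monotone for every `s ≥ 0`. The mean-transform weight factors
as `x^t y^t (x^(1-2t) + y^(1-2t)) / 2`, with `x`, `y` consecutive weights, so it is covered too.

By Hausdorff's theorem these products are moments of a probability measure on `[0, 1]`.
Multiplication by `√r e^{iφ}`, with Haar measure in the angle, is then a normal operator whose
restriction to the span of the monomials is the shift. -/

/-- A real sequence is completely monotone if all its iterated differences are nonnegative. -/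
def IsCompletelyMonotone (φ : ℕ → ℝ) : Prop := ∀ k n : ℕ, 0 ≤ (nabla^[k] φ) n

/-! ### Calculus of iterated differences and completely monotone sequences -/

theorem nabla_iterate_add (k : ℕ) (f g : ℕ → ℝ) :
    nabla^[k] (f + g) = nabla^[k] f + nabla^[k] g := by
  induction k generalizing f g with
  | zero => rfl
  | succ k ih =>
    simp only [Function.iterate_succ_apply]
    rw [← ih]
    congr 1
    ext n
    simp only [nabla, Pi.add_apply]
    ring

theorem nabla_iterate_const_mul (k : ℕ) (c : ℝ) (f : ℕ → ℝ) :
    nabla^[k] (fun n => c * f n) = fun n => c * (nabla^[k] f) n := by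
  induction k generalizing f with
  | zero => rfl
  | succ k ih =>
    simp only [Function.iterate_succ_apply]
    rw [← ih]
    congr 1
    ext n
    simp only [nabla]
    ring

theorem nabla_iterate_shift (k : ℕ) (f : ℕ → ℝ) :
    nabla^[k] (fun n => f (n + 1)) = fun n => (nabla^[k] f) (n + 1) := by
  induction k generalizing f with
  | zero => rfl
  | succ k ih =>
    simp only [Function.iterate_succ_apply]
    rw [← ih]
    rfl

theorem nabla_mul (f g : ℕ → ℝ) :
    nabla (f * g) = nabla f * g + (fun n => f (n + 1)) * nabla g := by
  ext n
  simp only [nabla, Pi.mul_apply, Pi.add_apply]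
  ring

/-- Leibniz rule. Only orders up to `k` are assumed, so that it can be used inside an induction on
the order. -/
theorem nabla_iterate_mul_nonneg {k : ℕ} {f g : ℕ → ℝ}
    (hf : ∀ j ≤ k, ∀ n, 0 ≤ (nabla^[j] f) n) (hg : ∀ j ≤ k, ∀ n, 0 ≤ (nabla^[j] g) n) (n : ℕ) :
    0 ≤ (nabla^[k] (f * g)) n := by
  induction k generalizing f g n with
  | zero => exact mul_nonneg (hf 0 le_rfl n) (hg 0 le_rfl n)
  | succ k ih =>
    rw [Function.iterate_succ_apply, nabla_mul, nabla_iterate_add]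
    refine add_nonneg (ih (fun j hj m => hf (j + 1) (by omega) m)
      (fun j hj => hg j (by omega)) n) (ih (fun j hj m => ?_) (fun j hj m => hg (j + 1) (by omega) m) n)
    rw [nabla_iterate_shift]
    exact hf j (by omega) (m + 1)

namespace IsCompletelyMonotone

variable {f g : ℕ → ℝ}

theorem nonneg (hf : IsCompletelyMonotone f) (n : ℕ) : 0 ≤ f n := hf 0 n

theorem zero : IsCompletelyMonotone 0 := by
  intro k n
  have := congrFun (nabla_iterate_const_mul k 0 0) n
  simp only [Pi.zero_apply, mul_zero, zero_mul] at this
  exact this.ge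

theorem one : IsCompletelyMonotone 1 := by
  intro k n
  cases k with
  | zero => simp
  | succ k =>
    have h : nabla 1 = 0 := by ext; simp [nabla]
    rw [Function.iterate_succ_apply, h]
    exact zero k n

theorem add (hf : IsCompletelyMonotone f) (hg : IsCompletelyMonotone g) :
    IsCompletelyMonotone (f + g) := by
  intro k n
  rw [nabla_iterate_add]
  exact add_nonneg (hf k n) (hg k n)

theorem const_mul (hf : IsCompletelyMonotone f) {c : ℝ} (hc : 0 ≤ c) :
    IsCompletelyMonotone (fun n => c * f n) := by
  intro k n
  rw [nabla_iterate_const_mul]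
  exact mul_nonneg hc (hf k n)

theorem shift (hf : IsCompletelyMonotone f) : IsCompletelyMonotone (fun n => f (n + 1)) := by
  intro k n
  rw [nabla_iterate_shift]
  exact hf k (n + 1)

theorem mul (hf : IsCompletelyMonotone f) (hg : IsCompletelyMonotone g) :
    IsCompletelyMonotone (f * g) :=
  fun _ => nabla_iterate_mul_nonneg (fun j _ => hf j) (fun j _ => hg j)

theorem pow (hf : IsCompletelyMonotone f) (k : ℕ) : IsCompletelyMonotone (f ^ k) := by
  induction k with
  | zero => simpa using one
  | succ k ih => rw [pow_succ]; exact ih.mul hf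

theorem sum {ι : Type*} (s : Finset ι) {F : ι → ℕ → ℝ} (hF : ∀ i ∈ s, IsCompletelyMonotone (F i)) :
    IsCompletelyMonotone (∑ i ∈ s, F i) :=
  Finset.sum_induction F IsCompletelyMonotone (fun _ _ => add) zero hF

theorem of_tendsto {ι : Type*} {l : Filter ι} [l.NeBot] {F : ι → ℕ → ℝ}
    (hF : ∀ i, IsCompletelyMonotone (F i)) (h : ∀ n, Tendsto (fun i => F i n) l (𝓝 (f n))) :
    IsCompletelyMonotone f := by
  have key : ∀ k n, Tendsto (fun i => (nabla^[k] (F i)) n) l (𝓝 ((nabla^[k] f) n)) := by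
    intro k
    induction k with
    | zero => exact h
    | succ k ih =>
      intro n
      simp only [Function.iterate_succ_apply', nabla]
      exact (ih n).sub (ih (n + 1))
  exact fun k n => ge_of_tendsto' (key k n) (fun i => hF i k n)

theorem of_hasSum {F : ℕ → ℕ → ℝ} (hF : ∀ i, IsCompletelyMonotone (F i))
    (h : ∀ n, HasSum (fun i => F i n) (f n)) : IsCompletelyMonotone f :=
  of_tendsto (F := fun s : Finset ℕ => ∑ i ∈ s, F i) (l := atTop) (fun s => sum s fun i _ => hF i)
    (fun n => by simpa [HasSum] using h n)

/-- The partial products of a sequence `w` with `1 - w` completely monotone and `w ≥ 0`. -/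
theorem prod_range {w : ℕ → ℝ} (hw0 : ∀ n, 0 ≤ w n) (hw : IsCompletelyMonotone (1 - w)) :
    IsCompletelyMonotone (fun n => ∏ i ∈ range n, w i) := by
  set γ : ℕ → ℝ := fun n => ∏ i ∈ range n, w i with hγ
  have hn : nabla γ = γ * (1 - w) := by
    ext n
    simp only [nabla, hγ, Finset.prod_range_succ, Pi.mul_apply, Pi.sub_apply, Pi.one_apply]
    ring
  -- By `∇γ = γ (1 - w)`, order `k + 1` for `γ` is order `k` for a product, which needs all lower
  -- orders of `γ` at once.
  have key : ∀ k, ∀ j ≤ k, ∀ n, 0 ≤ (nabla^[j] γ) n := by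
    intro k
    induction k with
    | zero =>
      intro j hj n
      obtain rfl : j = 0 := by omega
      exact Finset.prod_nonneg fun i _ => hw0 i
    | succ k ih =>
      intro j hj n
      rcases Nat.lt_or_ge j (k + 1) with h | h
      · exact ih j (by omega) n
      · obtain rfl : j = k + 1 := by omega
        rw [Function.iterate_succ_apply, hn]
        exact nabla_iterate_mul_nonneg ih (fun j _ => hw j) n
  exact fun k => key k k le_rfl

end IsCompletelyMonotone

/-! ### Powers and means of weights -/

theorem IsCompletelyAlternating.one_sub {ψ : ℕ → ℝ} (hψ : IsCompletelyAlternating ψ)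
    (h1 : ∀ n, ψ n ≤ 1) : IsCompletelyMonotone (1 - ψ) := by
  intro k n
  cases k with
  | zero => simpa using h1 n
  | succ k =>
    have h : nabla (1 - ψ) = fun n => (-1) * nabla ψ n := by ext; simp [nabla]
    rw [Function.iterate_succ_apply, h, nabla_iterate_const_mul]
    have := hψ (k + 1) (by omega) n
    rw [Function.iterate_succ_apply] at this
    linarith

/-- In `θ (θ - 1) ⋯ (θ - k)` the first factor is nonnegative and the other `k` are nonpositive. -/
theorem neg_one_pow_mul_choose_nonpos {θ : ℝ} (h0 : 0 ≤ θ) (h1 : θ ≤ 1) (k : ℕ) :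
    (-1) ^ (k + 1) * Ring.choose θ (k + 1) ≤ 0 := by
  have hd : ∀ k : ℕ, (-1) ^ (k + 1) * (descPochhammer ℤ (k + 1)).smeval θ ≤ 0 := by
    intro k
    induction k with
    | zero => simpa [descPochhammer_one] using h0
    | succ k ih =>
      rw [descPochhammer_succ_right, Polynomial.smeval_mul, pow_succ]
      have h : (Polynomial.X - ((k + 1 : ℕ) : Polynomial ℤ)).smeval θ = θ - (k + 1) := by
        simp [Polynomial.smeval_sub, Polynomial.smeval_natCast]
      rw [h]
      have hk : (0 : ℝ) ≤ k := Nat.cast_nonneg k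
      nlinarith [mul_nonneg (neg_nonneg.2 ih) (show (0 : ℝ) ≤ (k + 1) - θ by linarith)]
  have h := hd k
  rw [Ring.descPochhammer_eq_factorial_smul_choose, nsmul_eq_mul, mul_left_comm] at h
  exact nonpos_of_mul_nonpos_right h (by positivity)

/-- Expand `1 - (1 - u)^θ` in powers of `u = 1 - w`: the coefficients are nonnegative, and powers
and limits preserve complete monotonicity. Positivity of `w` keeps `u` inside the disc of
convergence. -/
theorem IsCompletelyMonotone.one_sub_rpow {w : ℕ → ℝ} (hw0 : ∀ n, 0 < w n)
    (hw : IsCompletelyMonotone (1 - w)) {θ : ℝ} (h0 : 0 ≤ θ) (h1 : θ ≤ 1) :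
    IsCompletelyMonotone (1 - fun n => w n ^ θ) := by
  have hs : ∀ n, HasSum (fun k => -((-1) ^ (k + 1) * Ring.choose θ (k + 1)) * ((1 - w) ^ (k + 1)) n)
      ((1 - fun n => w n ^ θ) n) := by
    intro n
    have hn := hw.nonneg n
    have hb : (-(1 - w n)) ∈ Metric.eball (0 : ℝ) 1 := by
      simp only [Pi.sub_apply, Pi.one_apply] at hn
      have := hw0 n
      rw [← ENNReal.ofReal_one, Metric.eball_ofReal, Metric.mem_ball, dist_zero_right, norm_neg,
        Real.norm_eq_abs, abs_lt]
      constructor <;> linarith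
    have h := (Real.one_add_rpow_hasFPowerSeriesOnBall_zero (a := θ)).hasSum hb
    simp only [binomialSeries_apply, zero_add, List.ofFn_const, List.prod_replicate,
      smul_eq_mul] at h
    have h' := ((hasSum_nat_add_iff' 1).2 h).neg
    have hL : (fun k => -((-1) ^ (k + 1) * Ring.choose θ (k + 1)) * ((1 - w) ^ (k + 1)) n) =
        fun k => -(Ring.choose θ (k + 1) * (-(1 - w n)) ^ (k + 1)) := by
      ext k
      rw [neg_pow (1 - w n)]
      simp only [Pi.pow_apply, Pi.sub_apply, Pi.one_apply]
      ring
    rw [hL]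
    simpa using h'
  exact .of_hasSum (fun k => (hw.pow (k + 1)).const_mul
    (neg_nonneg.2 (neg_one_pow_mul_choose_nonpos h0 h1 k))) hs

/-- Partial products of arbitrary positive powers. -/
theorem IsCompletelyMonotone.prod_range_rpow {w : ℕ → ℝ} (hw0 : ∀ n, 0 < w n)
    (hw : IsCompletelyMonotone (1 - w)) {s : ℝ} (hs : 0 ≤ s) :
    IsCompletelyMonotone (fun n => ∏ i ∈ range n, w i ^ s) := by
  -- Write `s = (m + 1) θ` with `θ ≤ 1`; using `m + 1` avoids division by zero.
  obtain ⟨m, hm⟩ := exists_nat_ge s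
  have hm0 : (0 : ℝ) < (m + 1 : ℕ) := by positivity
  have hθ1 : s / (m + 1 : ℕ) ≤ 1 := by
    rw [div_le_one hm0]; push_cast; linarith
  have h := (prod_range (fun n => (Real.rpow_pos_of_pos (hw0 n) _).le)
    (hw.one_sub_rpow hw0 (div_nonneg hs hm0.le) hθ1)).pow (m + 1)
  convert h using 1
  ext n
  rw [Pi.pow_apply, ← Finset.prod_pow]
  refine Finset.prod_congr rfl fun i _ => ?_
  rw [← Real.rpow_mul_natCast (hw0 i).le, div_mul_cancel₀ _ hm0.ne']

/-- The moments of the weights of the generalized mean transform. -/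
theorem IsCompletelyMonotone.prod_range_mean {x : ℕ → ℝ} (hx0 : ∀ n, 0 < x n)
    (hx : IsCompletelyMonotone (1 - x)) {t s : ℝ} (ht0 : 0 ≤ t) (ht : t ≤ 1 / 2) (hs : 0 ≤ s) :
    IsCompletelyMonotone (fun n => ∏ i ∈ range n,
      ((x (i + 1) ^ t * x i ^ (1 - t) + x (i + 1) ^ (1 - t) * x i ^ t) / 2) ^ s) := by
  have hy0 : ∀ n, 0 < x (n + 1) := fun n => hx0 (n + 1)
  have hy : IsCompletelyMonotone (1 - fun n => x (n + 1)) := hx.shift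
  have hθ0 : 0 ≤ 1 - 2 * t := by linarith
  have hθ1 : 1 - 2 * t ≤ 1 := by linarith
  -- Taking `x^t y^t` out of the mean leaves this average; `t ≤ 1/2` makes its exponent nonnegative.
  have hz : IsCompletelyMonotone
      (1 - fun n => (x (n + 1) ^ (1 - 2 * t) + x n ^ (1 - 2 * t)) / 2) := by
    convert ((hy.one_sub_rpow hy0 hθ0 hθ1).add (hx.one_sub_rpow hx0 hθ0 hθ1)).const_mul
      (c := 1 / 2) (by norm_num) using 1
    ext n
    simp only [Pi.sub_apply, Pi.add_apply, Pi.one_apply]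
    ring
  have hz0 : ∀ n, 0 < (x (n + 1) ^ (1 - 2 * t) + x n ^ (1 - 2 * t)) / 2 := fun n => by
    have := Real.rpow_pos_of_pos (hx0 n) (1 - 2 * t)
    have := Real.rpow_pos_of_pos (hy0 n) (1 - 2 * t)
    positivity
  convert ((hy.prod_range_rpow hy0 (mul_nonneg ht0 hs)).mul
    (hx.prod_range_rpow hx0 (mul_nonneg ht0 hs))).mul (hz.prod_range_rpow hz0 hs) using 1
  ext n
  simp only [Pi.mul_apply, ← Finset.prod_mul_distrib]
  refine Finset.prod_congr rfl fun i _ => ?_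
  have hxt := Real.rpow_pos_of_pos (hx0 i) t
  have hyt := Real.rpow_pos_of_pos (hy0 i) t
  rw [Real.rpow_mul (hx0 i).le, Real.rpow_mul (hy0 i).le, ← Real.mul_rpow hyt.le hxt.le,
    ← Real.mul_rpow (by positivity) (hz0 i).le]
  congr 1
  rw [show 1 - t = t + (1 - 2 * t) by ring, Real.rpow_add (hx0 i), Real.rpow_add (hy0 i)]
  ring

/-! ### Hausdorff moment theorem -/

/-- Binomial expansion of `(E + ∇)^M`, where `E` is the shift and `E + ∇` is the identity. -/
theorem sum_antidiagonal_choose_mul_nabla (γ : ℕ → ℝ) (M n : ℕ) :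
    ∑ ij ∈ antidiagonal M, (M.choose ij.1 : ℝ) * (nabla^[ij.2] γ) (n + ij.1) = γ n := by
  induction M generalizing γ n with
  | zero => simp
  | succ M ih =>
    rw [Finset.sum_antidiagonal_choose_succ_mul (fun i j => (nabla^[j] γ) (n + i)) M]
    have h1 : ∀ ij ∈ antidiagonal M, (M.choose ij.2 : ℝ) * (nabla^[ij.2] γ) (n + (ij.1 + 1)) =
        (M.choose ij.1 : ℝ) * (nabla^[ij.2] γ) (n + 1 + ij.1) := by
      intro ij hij
      rw [HasAntidiagonal.mem_antidiagonal] at hij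
      rw [← hij, Nat.choose_symm_add, show n + (ij.1 + 1) = n + 1 + ij.1 by ring]
    rw [Finset.sum_congr rfl h1, ih γ (n + 1)]
    have h2 := ih (nabla γ) n
    simp only [← Function.iterate_succ_apply] at h2
    rw [h2]
    simp [nabla]

/-- The weights of the Bernstein-type discrete measures approximating the Hausdorff measure. -/
def hausdorffWeight (γ : ℕ → ℝ) (m j : ℕ) : ℝ := m.choose j * (nabla^[m - j] γ) j

/-- The discrete measures have exact binomial moments: terms with `j < n` vanish, and `C(m,j) C(j,n)
= C(m,n) C(m-n,j-n)` reduces the rest to the expansion of `γ n`. -/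
theorem sum_choose_mul_hausdorffWeight (γ : ℕ → ℝ) {m n : ℕ} (h : n ≤ m) :
    ∑ j ∈ range (m + 1), (j.choose n : ℝ) * hausdorffWeight γ m j = m.choose n * γ n := by
  obtain ⟨M, rfl⟩ := Nat.exists_eq_add_of_le h
  rw [add_assoc, Finset.sum_range_add, Finset.sum_eq_zero, zero_add,
    ← sum_antidiagonal_choose_mul_nabla γ M n, Finset.Nat.sum_antidiagonal_eq_sum_range_succ_mk,
    Finset.mul_sum]
  · refine Finset.sum_congr rfl fun i hi => ?_
    have hi' : i ≤ M := by simpa [Nat.lt_succ_iff] using hi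
    have hc := Nat.choose_mul (n := n + M) (k := n + i) (s := n) (by omega)
    rw [Nat.add_sub_cancel_left, Nat.add_sub_cancel_left] at hc
    have hc' : ((n + M).choose (n + i) : ℝ) * (n + i).choose n = (n + M).choose n * M.choose i := by
      exact_mod_cast hc
    rw [hausdorffWeight, Nat.add_sub_add_left]
    linear_combination (nabla^[M - i] γ) (n + i) * hc'
  · intro j hj
    rw [Nat.choose_eq_zero_of_lt (mem_range.1 hj)]
    simp

/-- Passes from binomial to power moments, uniformly in `j`. Raising `n` multiplies the ratio by `(j
- n) / (m - n)`, which is within `n / (m - n)` of `j / m`. -/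
theorem exists_choose_div_choose_sub_pow_le (n : ℕ) : ∃ ε : ℕ → ℝ, Tendsto ε atTop (𝓝 0) ∧
    ∀ m, n ≤ m → ∀ j ≤ m, |(j.choose n : ℝ) / m.choose n - (j / m : ℝ) ^ n| ≤ ε m := by
  induction n with
  | zero => exact ⟨0, tendsto_const_nhds, by simp⟩
  | succ n ih =>
    obtain ⟨ε, hε, h⟩ := ih
    refine ⟨fun m => ε m + n / ((m : ℝ) - n), ?_, ?_⟩
    · rw [← add_zero (0 : ℝ)]
      refine hε.add (Tendsto.const_div_atTop ?_ _)
      exact tendsto_atTop_add_const_right _ _ tendsto_natCast_atTop_atTop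
    · intro m hm j hj
      have hmn : (n : ℝ) + 1 ≤ m := by exact_mod_cast hm
      have hn0 : (0 : ℝ) ≤ n := Nat.cast_nonneg n
      have hm0 : (0 : ℝ) < m := by linarith
      have hd : (0 : ℝ) < m - n := by linarith
      have hj0 : (0 : ℝ) ≤ j := Nat.cast_nonneg j
      have hjm : (j : ℝ) ≤ m := by exact_mod_cast hj
      have hstep : ∀ i : ℕ, (i.choose (n + 1) : ℝ) * (n + 1) = i.choose n * (i - n) := by
        intro i
        rcases le_or_gt n i with hi | hi
        · have := Nat.choose_succ_right_eq i n
          rw [← Nat.cast_sub hi]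
          exact_mod_cast this
        · rw [Nat.choose_eq_zero_of_lt hi, Nat.choose_eq_zero_of_lt (by omega)]
          simp
      have hcm : (0 : ℝ) < m.choose n := by exact_mod_cast Nat.choose_pos (by omega)
      set g : ℝ := (j.choose n : ℝ) / m.choose n with hg
      have hg0 : 0 ≤ g := by positivity
      have hg1 : g ≤ 1 := by
        rw [hg, div_le_one hcm]
        exact_mod_cast Nat.choose_le_choose n hj
      have hratio : (j.choose (n + 1) : ℝ) / m.choose (n + 1) = g * ((j - n) / (m - n)) := by
        have hn1 : (n : ℝ) + 1 ≠ 0 := by positivity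
        rw [← mul_div_mul_right _ _ hn1, hstep, hstep, hg, div_mul_div_comm]
      have hx0 : (0 : ℝ) ≤ j / m := by positivity
      have hx1 : (j : ℝ) / m ≤ 1 := by rwa [div_le_one hm0]
      have hb : |((j : ℝ) - n) / (m - n) - j / m| ≤ n / (m - n) := by
        have : ((j : ℝ) - n) / (m - n) - j / m = -((n / (m - n)) * (1 - j / m)) := by
          field_simp
          ring
        rw [this, abs_neg, abs_of_nonneg (mul_nonneg (by positivity) (by linarith))]
        exact mul_le_of_le_one_right (by positivity) (by linarith)
      rw [hratio, pow_succ, show g * ((j - n) / (m - n)) - (j / m : ℝ) ^ n * (j / m) =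
        (g - (j / m : ℝ) ^ n) * (j / m) + g * ((j - n) / (m - n) - j / m) by ring]
      refine (abs_add_le _ _).trans (add_le_add ?_ ?_)
      · rw [abs_mul, abs_of_nonneg hx0]
        exact (mul_le_of_le_one_right (abs_nonneg _) hx1).trans (h m (by omega) j hj)
      · rw [abs_mul, abs_of_nonneg hg0]
        exact (mul_le_of_le_one_left (abs_nonneg _) hg1).trans hb

theorem IsCompletelyMonotone.hausdorffWeight_nonneg {γ : ℕ → ℝ} (hγ : IsCompletelyMonotone γ)
    (m j : ℕ) : 0 ≤ hausdorffWeight γ m j :=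
  mul_nonneg (Nat.cast_nonneg _) (hγ _ _)

theorem sum_hausdorffWeight (γ : ℕ → ℝ) (m : ℕ) :
    ∑ j ∈ range (m + 1), hausdorffWeight γ m j = γ 0 := by
  simpa using sum_choose_mul_hausdorffWeight γ (Nat.zero_le m)

/-- The weights are nonnegative with total mass `γ 0`, so the uniform error `ε m` contributes at
most `ε m * γ 0`. -/
theorem tendsto_sum_pow_mul_hausdorffWeight {γ : ℕ → ℝ} (hγ : IsCompletelyMonotone γ) (n : ℕ) :
    Tendsto (fun m : ℕ => ∑ j ∈ range (m + 1), hausdorffWeight γ m j * (j / m : ℝ) ^ n) atTop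
      (𝓝 (γ n)) := by
  obtain ⟨ε, hε, h⟩ := exists_choose_div_choose_sub_pow_le n
  rw [tendsto_iff_dist_tendsto_zero]
  refine squeeze_zero' (.of_forall fun _ => dist_nonneg) ?_ (by simpa using hε.mul_const (γ 0))
  filter_upwards [eventually_ge_atTop n] with m hm
  have hcm : (m.choose n : ℝ) ≠ 0 := by exact_mod_cast (Nat.choose_pos hm).ne'
  have hγn : γ n = ∑ j ∈ range (m + 1), hausdorffWeight γ m j * (j.choose n / m.choose n) := by
    rw [eq_comm, ← mul_right_inj' hcm, ← sum_choose_mul_hausdorffWeight γ hm, Finset.mul_sum]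
    refine Finset.sum_congr rfl fun j _ => ?_
    field_simp
  rw [dist_comm, Real.dist_eq, hγn, ← Finset.sum_sub_distrib, ← sum_hausdorffWeight γ m,
    Finset.mul_sum]
  refine (Finset.abs_sum_le_sum_abs _ _).trans (Finset.sum_le_sum fun j hj => ?_)
  have hw := hγ.hausdorffWeight_nonneg m j
  rw [← mul_sub, abs_mul, abs_of_nonneg hw, mul_comm]
  exact mul_le_mul_of_nonneg_right (h m hm j (by simpa [Nat.lt_succ_iff] using hj)) hw

/-- The Hausdorff moment theorem: a normalized completely monotone sequence is the moment sequence
of a probability measure on the unit interval. -/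
theorem IsCompletelyMonotone.exists_moment {γ : ℕ → ℝ} (hγ : IsCompletelyMonotone γ)
    (h0 : γ 0 = 1) : ∃ μ : ProbabilityMeasure unitInterval,
      ∀ n, ∫ x, (x : ℝ) ^ n ∂(μ : Measure unitInterval) = γ n := by
  -- The atoms are the points `j / m`; the projection only places them in the interval type.
  let pt : ℕ → ℕ → unitInterval := fun m j => Set.projIcc 0 1 zero_le_one ((j : ℝ) / m)
  let ν : ℕ → Measure unitInterval := fun m =>
    ∑ j ∈ range (m + 1), ENNReal.ofReal (hausdorffWeight γ m j) • Measure.dirac (pt m j)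
  have hν : ∀ m, IsProbabilityMeasure (ν m) := by
    intro m
    constructor
    simp only [ν, Measure.coe_finsetSum, Finset.sum_apply, Measure.smul_apply, measure_univ,
      smul_eq_mul, mul_one]
    rw [← ENNReal.ofReal_sum_of_nonneg fun j _ => hγ.hausdorffWeight_nonneg m j,
      sum_hausdorffWeight, h0, ENNReal.ofReal_one]
  have hint : ∀ m n, ∫ x, (x : ℝ) ^ n ∂(ν m) =
      ∑ j ∈ range (m + 1), hausdorffWeight γ m j * (j / m : ℝ) ^ n := by
    intro m n
    have hi : ∀ j ∈ range (m + 1), Integrable (fun x : unitInterval => (x : ℝ) ^ n)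
        (ENNReal.ofReal (hausdorffWeight γ m j) • Measure.dirac (pt m j)) := fun j _ =>
      (integrable_dirac (by simp)).smul_measure ENNReal.ofReal_ne_top
    simp only [ν]
    rw [integral_finsetSum_measure hi]
    refine Finset.sum_congr rfl fun j hj => ?_
    have hjm : (j : ℝ) ≤ m := by exact_mod_cast (by simpa [Nat.lt_succ_iff] using hj)
    rw [integral_smul_measure, integral_dirac, ENNReal.toReal_ofReal (hγ.hausdorffWeight_nonneg m j),
      smul_eq_mul]
    simp only [pt]
    rw [Set.projIcc_of_mem zero_le_one
      ⟨by positivity, div_le_one_of_le₀ hjm (Nat.cast_nonneg _)⟩]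
  let P : ℕ → ProbabilityMeasure unitInterval := fun m => ⟨ν m, hν m⟩
  -- Compactness of the space of probability measures gives a weak limit along a nonprincipal
  -- ultrafilter, with no subsequence to extract.
  let U : Ultrafilter ℕ := Filter.hyperfilter ℕ
  obtain ⟨μ, -, hμ⟩ := (isCompact_univ (X := ProbabilityMeasure unitInterval)).ultrafilter_le_nhds
    (U.map P) (by simp)
  refine ⟨μ, fun n => ?_⟩
  have hlim : Tendsto P U (𝓝 μ) := hμ
  rw [ProbabilityMeasure.tendsto_iff_forall_integral_tendsto] at hlim
  let f : C(unitInterval, ℝ) := ⟨fun x => (x : ℝ) ^ n, by fun_prop⟩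
  have h1 := hlim (BoundedContinuousFunction.mkOfCompact f)
  have h2 : Tendsto (fun m => ∫ x, (x : ℝ) ^ n ∂(ν m)) U (𝓝 (γ n)) := by
    simp only [hint]
    exact (tendsto_sum_pow_mul_hausdorffWeight hγ n).mono_left
      (Nat.hyperfilter_le_atTop)
  exact tendsto_nhds_unique h1 h2

/-! ### Berger's theorem: a normal model for the shift -/

theorem continuousLinearMap_ext_single {F : Type*} [NormedAddCommGroup F] [NormedSpace ℂ F]
    {A B : EllTwo →L[ℂ] F} (h : ∀ n, A (lp.single 2 n 1) = B (lp.single 2 n 1)) : A = B := by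
  refine lp.ext_continuousLinearMap (by simp) fun n => ?_
  ext
  exact h n

/-- A weighted shift is subnormal if it is modelled on an orthonormal sequence by a normal
operator. -/
theorem isSubnormal_weightedShift_of_orthonormal {w : ℕ → ℝ} (hw : IsBoundedSeq w) {K : Type}
    [NormedAddCommGroup K] [InnerProductSpace ℂ K] [CompleteSpace K] {v : ℕ → K}
    (hv : Orthonormal ℂ v) (N : K →L[ℂ] K) (hN : IsStarNormal N)
    (hNv : ∀ n, N (v n) = (w n : ℂ) • v (n + 1)) : IsSubnormal (weightedShift w hw) := by
  have hV : ∀ n, hv.orthogonalFamily.linearIsometry (lp.single 2 n 1) = v n := by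
    intro n
    rw [OrthogonalFamily.linearIsometry_apply_single]
    simp
  refine ⟨K, _, _, _, hv.orthogonalFamily.linearIsometry, N, hN, fun x => ?_⟩
  have key : N ∘L hv.orthogonalFamily.linearIsometry.toContinuousLinearMap =
      hv.orthogonalFamily.linearIsometry.toContinuousLinearMap ∘L weightedShift w hw := by
    refine continuousLinearMap_ext_single fun n => ?_
    simp only [ContinuousLinearMap.comp_apply, LinearIsometry.coe_toContinuousLinearMap]
    rw [hV, hNv, weightedShift_single, map_smul, hV]
  exact DFunLike.congr_fun key x

/-- Integration against a finite measure as a positive functional. -/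
noncomputable def integralPositiveLinearMap {X : Type*} [TopologicalSpace X] [CompactSpace X] [MeasurableSpace X]
    [OpensMeasurableSpace X] (μ : Measure X) [IsFiniteMeasure μ] : C(X, ℂ) →ₚ[ℂ] ℂ :=
  PositiveLinearMap.mk₀
    { toFun := fun g => ∫ x, g x ∂μ
      map_add' := fun g h => integral_add
        (g.continuous.integrable_of_hasCompactSupport (HasCompactSupport.of_compactSpace g))
        (h.continuous.integrable_of_hasCompactSupport (HasCompactSupport.of_compactSpace h))
      map_smul' := fun c g => integral_const_mul c g }
    fun g hg => by
      have h : ∀ x, g x = ((g x).re : ℂ) := fun x => (Complex.eq_re_of_ofReal_le (hg x))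
      change 0 ≤ ∫ x, g x ∂μ
      rw [integral_congr_ae (.of_forall h), integral_complex_ofReal]
      exact Complex.zero_le_real.2 (integral_nonneg fun x => (Complex.le_def.1 (hg x)).1)

/-- The polar coordinate function on the closed disc, in terms of the square of the radius. -/
noncomputable def polarCoordinate : C(unitInterval × AddCircle (1 : ℝ), ℂ) :=
  ⟨fun p => (Real.sqrt p.1 : ℂ) * fourier 1 p.2, by fun_prop⟩

theorem polarCoordinate_pow_apply (n : ℕ) (p : unitInterval × AddCircle (1 : ℝ)) :
    (polarCoordinate ^ n) p = ((Real.sqrt p.1 ^ n : ℝ) : ℂ) * fourier n p.2 := by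
  induction n with
  | zero => simp
  | succ n ih =>
    rw [pow_succ, ContinuousMap.mul_apply, ih]
    push_cast
    rw [fourier_add]
    change _ * ((Real.sqrt p.1 : ℂ) * fourier 1 p.2) = _
    ring

/-- For nonzero frequency, a suitable translation changes the sign of the character, so its integral
vanishes. -/
theorem integral_fourier_sub (i j : ℕ) :
    ∫ u : AddCircle (1 : ℝ), fourier ((j : ℤ) - i) u ∂AddCircle.haarAddCircle =
      if i = j then (1 : ℂ) else 0 := by
  split_ifs with h
  · simp [h]
  · exact integral_eq_zero_of_add_right_eq_neg (μ := AddCircle.haarAddCircle)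
      (fourier_add_half_inv_index (by omega) one_pos)

/-- The angle makes distinct monomials orthogonal; on the diagonal `√x ^ (2i) = x ^ i` gives the
moment of `μ`. -/
theorem integral_star_polarCoordinate_pow_mul (μ : ProbabilityMeasure unitInterval) (i j : ℕ) :
    integralPositiveLinearMap ((μ : Measure unitInterval).prod
      (AddCircle.haarAddCircle : Measure (AddCircle (1 : ℝ))))
      (star (polarCoordinate ^ i) * polarCoordinate ^ j) =
      if i = j then ((∫ x, (x : ℝ) ^ i ∂(μ : Measure unitInterval) : ℝ) : ℂ) else 0 := by
  have h : ∀ p, (star (polarCoordinate ^ i) * polarCoordinate ^ j) p =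
      ((Real.sqrt p.1 ^ (i + j) : ℝ) : ℂ) * fourier ((j : ℤ) - i) p.2 := by
    intro p
    rw [ContinuousMap.mul_apply, ContinuousMap.star_apply, polarCoordinate_pow_apply,
      polarCoordinate_pow_apply, star_mul', Complex.star_def, Complex.conj_ofReal,
      ← fourier_neg, sub_eq_add_neg, fourier_add, pow_add]
    push_cast
    ring
  change ∫ p, (star (polarCoordinate ^ i) * polarCoordinate ^ j) p ∂_ = _
  simp only [h]
  rw [integral_prod_mul (fun x : unitInterval => ((Real.sqrt x ^ (i + j) : ℝ) : ℂ))
    (fun u => fourier ((j : ℤ) - i) u), integral_fourier_sub]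
  split_ifs with hij
  · subst hij
    rw [mul_one, integral_complex_ofReal]
    congr 2
    ext x
    rw [← two_mul, pow_mul, Real.sq_sqrt x.2.1]
  · simp

/-- The sufficiency half of Berger's theorem. -/
theorem isSubnormal_weightedShift {w : ℕ → ℝ} (hw : IsBoundedSeq w) (hpos : ∀ n, 0 < w n)
    (hγ : IsCompletelyMonotone (fun n => ∏ i ∈ range n, w i ^ 2)) :
    IsSubnormal (weightedShift w hw) := by
  obtain ⟨μ, hμ⟩ := hγ.exists_moment (by simp)
  set f := integralPositiveLinearMap ((μ : Measure unitInterval).prod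
      (AddCircle.haarAddCircle : Measure (AddCircle (1 : ℝ)))) with hf
  set c : ℕ → ℝ := fun n => ∏ i ∈ range n, w i with hc
  have hc0 : ∀ n, 0 < c n := fun n => Finset.prod_pos fun i _ => hpos i
  -- The monomials in the GNS space, which plays the role of `L²`; the norm of `z n` is `c n`.
  let z : ℕ → f.GNS := fun n => ((f.toPreGNS (polarCoordinate ^ n) : f.PreGNS) : f.GNS)
  have hz : ∀ i j, inner ℂ (z i) (z j) = if i = j then ((c i ^ 2 : ℝ) : ℂ) else 0 := by
    intro i j
    simp only [z]
    rw [UniformSpace.Completion.inner_coe, PositiveLinearMap.preGNS_inner_def]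
    simp only [PositiveLinearMap.ofPreGNS_toPreGNS]
    rw [hf, integral_star_polarCoordinate_pow_mul, hμ, hc, Finset.prod_pow]
  have hv : Orthonormal ℂ fun n => ((c n : ℂ)⁻¹) • z n := by
    rw [orthonormal_iff_ite]
    intro i j
    rw [inner_smul_left, inner_smul_right, hz]
    split_ifs with hij
    · subst hij
      have : (c i : ℂ) ≠ 0 := by exact_mod_cast (hc0 i).ne'
      simp only [map_inv₀, Complex.conj_ofReal]
      push_cast
      field_simp
    · simp
  refine isSubnormal_weightedShift_of_orthonormal hw hv (f.gnsStarAlgHom polarCoordinate) ?_ ?_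
  -- Normality is inherited from a commutative algebra through a star homomorphism.
  · constructor
    rw [← map_star]
    exact (Commute.all (star polarCoordinate) polarCoordinate).map f.gnsStarAlgHom
  · intro n
    have h1 : f.gnsStarAlgHom polarCoordinate (z n) = z (n + 1) := by
      simp only [z]
      change f.gnsNonUnitalStarAlgHom polarCoordinate _ = _
      rw [PositiveLinearMap.gnsNonUnitalStarAlgHom_apply_coe,
        PositiveLinearMap.leftMulMapPreGNS_apply, pow_succ']
      simp
    rw [map_smul, h1, smul_smul]
    congr 1
    have hcn : (c n : ℂ) ≠ 0 := by exact_mod_cast (hc0 n).ne'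
    have hwn : (w n : ℂ) ≠ 0 := by exact_mod_cast (hpos n).ne'
    simp only [hc, Finset.prod_range_succ] at hcn ⊢
    push_cast at hcn ⊢
    field_simp

/-! ### Polar decomposition and mean transform of a weighted shift -/

section Eigenvector

variable {H : Type*} [NormedAddCommGroup H] [InnerProductSpace ℂ H] [CompleteSpace H]

/-- True for constants and the identity, stable under sums and products, and closed in `f`, hence
true by Stone–Weierstrass. The eigenvalue is in the spectrum because `r - T` kills `x`. -/
theorem cfc_apply_eigenvector {T : H →L[ℂ] H} (hT : IsSelfAdjoint T) {x : H} (hx : x ≠ 0) {r : ℝ}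
    (h : T x = (r : ℂ) • x) {f : ℝ → ℝ} (hf : ContinuousOn f (spectrum ℝ T)) :
    cfc f T x = (f r : ℂ) • x := by
  have hr : r ∈ spectrum ℝ T := by
    rw [spectrum.mem_iff]
    intro hu
    obtain ⟨S, hS⟩ := hu.exists_left_inv
    have h0 : (algebraMap ℝ (H →L[ℂ] H) r - T) x = 0 := by
      rw [Algebra.algebraMap_eq_smul_one]
      simp [h]
    have h1 := DFunLike.congr_fun hS x
    rw [mul_apply_eq_comp, h0, map_zero] at h1
    exact hx h1.symm
  rw [cfc_apply f T hT hf]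
  have key : ∀ g : C(spectrum ℝ T, ℝ), cfcHom hT g x = (g ⟨r, hr⟩ : ℂ) • x := by
    intro g
    induction g using ContinuousMap.induction_on_of_compact with
    | const c =>
      have : ContinuousMap.const (spectrum ℝ T) c = algebraMap ℝ C(spectrum ℝ T, ℝ) c := rfl
      rw [this, AlgHomClass.commutes, Algebra.algebraMap_eq_smul_one]
      simp
    | id => rw [cfcHom_id]; exact h
    | star_id => rw [star_trivial, cfcHom_id]; exact h
    | add f g hf hg => rw [map_add, add_apply, hf, hg, ← add_smul]; simp
    | mul f g hf hg =>
      rw [map_mul, mul_apply_eq_comp, hg, map_smul, hf, smul_smul]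
      simp [mul_comm]
    | frequently g hg =>
      have hcl : IsClosed {g : C(spectrum ℝ T, ℝ) | cfcHom hT g x = (g ⟨r, hr⟩ : ℂ) • x} := by
        refine isClosed_eq ?_ ?_
        · exact (ContinuousLinearMap.apply ℂ H x).continuous.comp (cfcHom_continuous hT)
        · exact (Complex.continuous_ofReal.comp (continuous_eval_const _)).smul continuous_const
      exact hcl.mem_of_frequently_of_tendsto hg tendsto_id
  exact key _

theorem rpow_apply_eigenvector {T : H →L[ℂ] H} (hT : 0 ≤ T) {x : H} (hx : x ≠ 0) {r : ℝ}
    (h : T x = (r : ℂ) • x) {t : ℝ} (ht : 0 ≤ t) : (T ^ t) x = ((r ^ t : ℝ) : ℂ) • x := by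
  rw [CFC.rpow_eq_cfc_real hT]
  exact cfc_apply_eigenvector (IsSelfAdjoint.of_nonneg hT) hx h
    (Real.continuous_rpow_const ht).continuousOn

/-- If `|T| = R⋆ R` and `T = U |T|` with `U` isometric, then the generalized Aluthge transform
acts on eigenvectors of `|T|` in the expected way. -/
theorem generalizedAluthge_apply_eigenvector {T U R : H →L[ℂ] H}
    (hR : (star R * R) * (star R * R) = star T * T) (hT : T = U * (star R * R))
    (hU : ∀ x, ‖U x‖ = ‖x‖) (hker : ∀ x, T x = 0 → x = 0) {x y : H} (hx : x ≠ 0) (hUx : U x = y)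
    {a b : ℝ} (ha : (star R * R) x = (a : ℂ) • x) (hb : (star R * R) y = (b : ℂ) • y)
    {t : ℝ} (h0 : 0 ≤ t) (h1 : t ≤ 1) :
    generalizedAluthge T t x = ((b ^ t * a ^ (1 - t) : ℝ) : ℂ) • y := by
  have habs : CFC.abs T = star R * R := CFC.sqrt_unique hR (star_mul_self_nonneg _)
  have hU0 : ∀ x, U x = 0 ↔ x = 0 := fun x => by rw [← norm_eq_zero, hU, norm_eq_zero]
  -- By uniqueness of the polar decomposition; the kernels agree since both are trivial.
  have hpol : polarPart T = U := by
    refine (existsUnique_isPolarPart T).unique (isPolarPart_polarPart _)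
      ⟨by rw [habs]; exact hT, fun x _ => hU x, ?_⟩
    ext x
    simp only [LinearMap.mem_ker, ContinuousLinearMap.coe_coe]
    rw [hU0]
    exact ⟨fun h => by rw [h, map_zero], hker x⟩
  have hy : y ≠ 0 := by rwa [← hUx, Ne, hU0]
  have hpos : 0 ≤ star R * R := star_mul_self_nonneg _
  rw [generalizedAluthge, hpol, habs, mul_apply_eq_comp, mul_apply_eq_comp,
    rpow_apply_eigenvector hpos hx ha (by linarith), map_smul, map_smul, hUx,
    rpow_apply_eigenvector hpos hy hb h0, smul_smul]
  congr 1
  push_cast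
  ring

end Eigenvector

theorem single_ne_zero (n : ℕ) : (lp.single 2 n 1 : EllTwo) ≠ 0 := by
  rw [← norm_ne_zero_iff, lp.norm_single (by norm_num)]
  simp

theorem star_weightedShift_single {w : ℕ → ℝ} (hw : IsBoundedSeq w) (n : ℕ) :
    star (weightedShift w hw) (lp.single 2 (n + 1) 1) = (w n : ℂ) • (lp.single 2 n 1 : EllTwo) := by
  refine ext_inner_right ℂ fun x => ?_
  rw [ContinuousLinearMap.star_eq_adjoint, ContinuousLinearMap.adjoint_inner_left, inner_smul_left,
    lp.inner_single_left, lp.inner_single_left]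
  change inner ℂ 1 (shiftSeq w x (n + 1)) = _
  simp [shiftSeq]

theorem star_mul_weightedShift_single {w : ℕ → ℝ} (hw : IsBoundedSeq w) (n : ℕ) :
    (star (weightedShift w hw) * weightedShift w hw) (lp.single 2 n 1) =
      ((w n ^ 2 : ℝ) : ℂ) • (lp.single 2 n 1 : EllTwo) := by
  rw [mul_apply_eq_comp, weightedShift_single, map_smul, star_weightedShift_single, smul_smul]
  congr 1
  push_cast
  ring

theorem IsBoundedSeq.sqrt {w : ℕ → ℝ} (hw : IsBoundedSeq w) : IsBoundedSeq fun n => √(w n) := by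
  obtain ⟨C, hC⟩ := hw
  refine ⟨√C, fun n => ?_⟩
  rw [abs_of_nonneg (Real.sqrt_nonneg _)]
  exact Real.sqrt_le_sqrt ((le_abs_self _).trans (hC n))

theorem isBoundedSeq_of_le_one {w : ℕ → ℝ} (h0 : ∀ n, 0 ≤ w n) (h1 : ∀ n, w n ≤ 1) :
    IsBoundedSeq w :=
  ⟨1, fun n => by rw [abs_of_nonneg (h0 n)]; exact h1 n⟩

theorem isBoundedSeq_one : IsBoundedSeq fun _ => 1 := ⟨1, by simp⟩

theorem weightedShift_norm_sq {w : ℕ → ℝ} (hw : IsBoundedSeq w) (x : EllTwo) :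
    HasSum (fun n => (w n) ^ 2 * ‖x n‖ ^ 2) (‖weightedShift w hw x‖ ^ 2) := by
  have h := (hasSum_nat_add_iff' 1).2 (hasSum_norm_sq (weightedShift w hw x))
  have hs : ∀ n, weightedShift w hw x n = shiftSeq w x n := fun _ => rfl
  simpa [hs, shiftSeq, mul_pow] using h

theorem norm_weightedShift_one_apply (x : EllTwo) :
    ‖weightedShift (fun _ => 1) isBoundedSeq_one x‖ = ‖x‖ := by
  have h := (weightedShift_norm_sq isBoundedSeq_one x).unique (by simpa using hasSum_norm_sq x)
  exact (sq_eq_sq₀ (norm_nonneg _) (norm_nonneg _)).1 h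

theorem norm_weightedShift_le_one {w : ℕ → ℝ} (hw : IsBoundedSeq w) (h0 : ∀ n, 0 ≤ w n)
    (h1 : ∀ n, w n ≤ 1) : ‖weightedShift w hw‖ ≤ 1 := by
  refine ContinuousLinearMap.opNorm_le_bound _ zero_le_one fun x => ?_
  rw [one_mul, ← sq_le_sq₀ (norm_nonneg _) (norm_nonneg _)]
  exact hasSum_le (fun n => mul_le_of_le_one_left (sq_nonneg _) (pow_le_one₀ (h0 n) (h1 n)))
    (weightedShift_norm_sq hw x) (hasSum_norm_sq x)

theorem le_one_of_norm_weightedShift_le_one {w : ℕ → ℝ} (hw : IsBoundedSeq w)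
    (h : ‖weightedShift w hw‖ ≤ 1) (n : ℕ) : w n ≤ 1 := by
  have h1 := (weightedShift w hw).le_of_opNorm_le h (lp.single 2 n 1)
  rw [weightedShift_single, norm_smul, lp.norm_single (by norm_num),
    lp.norm_single (by norm_num)] at h1
  simp only [Complex.norm_real, Real.norm_eq_abs, norm_one, mul_one] at h1
  exact (le_abs_self _).trans h1

/-- Realizes the diagonal operator `|W_w|` as `R⋆ R` with `R = W_√w`, so positivity is automatic. -/
theorem star_mul_weightedShift_sqrt_single {w : ℕ → ℝ} (hw : IsBoundedSeq w) (h0 : ∀ n, 0 ≤ w n)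
    (n : ℕ) : (star (weightedShift _ hw.sqrt) * weightedShift _ hw.sqrt) (lp.single 2 n 1) =
      (w n : ℂ) • (lp.single 2 n 1 : EllTwo) := by
  rw [star_mul_weightedShift_single, Real.sq_sqrt (h0 n)]

/-- Here `|W_w|` is diagonal with entries `w n` and `U` is the unweighted shift, so the left factor
`|T|^t` sees `w (n + 1)`. -/
theorem generalizedAluthge_weightedShift_single {w : ℕ → ℝ} (hw : IsBoundedSeq w)
    (hpos : ∀ n, 0 < w n) {t : ℝ} (h0 : 0 ≤ t) (h1 : t ≤ 1) (n : ℕ) :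
    generalizedAluthge (weightedShift w hw) t (lp.single 2 n 1) =
      ((w (n + 1) ^ t * w n ^ (1 - t) : ℝ) : ℂ) • (lp.single 2 (n + 1) 1 : EllTwo) := by
  have hD := star_mul_weightedShift_sqrt_single hw fun n => (hpos n).le
  refine generalizedAluthge_apply_eigenvector (U := weightedShift (fun _ => 1) isBoundedSeq_one)
    (R := weightedShift _ hw.sqrt) (continuousLinearMap_ext_single fun n => ?_)
    (continuousLinearMap_ext_single fun n => ?_) norm_weightedShift_one_apply (fun x h => ?_)
    (single_ne_zero n) (by rw [weightedShift_single]; simp) (hD n) (hD (n + 1)) h0 h1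
  · rw [star_mul_weightedShift_single, mul_apply_eq_comp, hD, map_smul, hD, smul_smul]
    congr 1
    push_cast
    ring
  · rw [mul_apply_eq_comp, hD, map_smul, weightedShift_single, weightedShift_single]
    simp
  · ext n
    have hn : shiftSeq w x (n + 1) = 0 := congrArg (fun y : EllTwo => y (n + 1)) h
    simp only [shiftSeq, mul_eq_zero, Complex.ofReal_eq_zero, (hpos n).ne', false_or] at hn
    exact hn

theorem generalizedMeanTransform_weightedShift {w : ℕ → ℝ} (hw : IsBoundedSeq w)
    (hpos : ∀ n, 0 < w n) {t : ℝ} (h0 : 0 ≤ t) (h1 : t ≤ 1)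
    (hβ : IsBoundedSeq fun n => (w (n + 1) ^ t * w n ^ (1 - t) + w (n + 1) ^ (1 - t) * w n ^ t) / 2) :
    generalizedMeanTransform (weightedShift w hw) t = weightedShift _ hβ := by
  refine continuousLinearMap_ext_single fun n => ?_
  rw [generalizedMeanTransform, smul_apply, add_apply,
    generalizedAluthge_weightedShift_single hw hpos h0 h1,
    generalizedAluthge_weightedShift_single hw hpos (by linarith) (by linarith),
    weightedShift_single, ← add_smul, smul_smul, sub_sub_cancel]
  congr 1
  push_cast
  ring

/-! ### From complete monotonicity to the conclusions -/

/-- Contractivity, moment infinite divisibility and subnormality, from complete monotonicity of the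
moments of all the powers. -/
theorem weightedShift_contractive_isMID_isSubnormal {β : ℕ → ℝ} (hβ : IsBoundedSeq β)
    (hpos : ∀ n, 0 < β n) (h1 : ∀ n, β n ≤ 1)
    (h : ∀ s : ℝ, 0 ≤ s → IsCompletelyMonotone (fun n => ∏ i ∈ range n, β i ^ s)) :
    ‖weightedShift β hβ‖ ≤ 1 ∧ IsMID (weightedShift β hβ) ∧ IsSubnormal (weightedShift β hβ) := by
  have hsub : ∀ s : ℝ, 0 < s → ∀ hs : IsBoundedSeq (fun n => β n ^ s),
      IsSubnormal (weightedShift (fun n => β n ^ s) hs) := by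
    intro s hs hb
    refine isSubnormal_weightedShift hb (fun n => Real.rpow_pos_of_pos (hpos n) s) ?_
    -- Berger's moments use squared weights, hence the exponent `2 s`.
    convert h (s * (2 : ℕ)) (by positivity) using 4 with n i
    rw [Real.rpow_mul_natCast (hpos i).le]
  refine ⟨norm_weightedShift_le_one hβ (fun n => (hpos n).le) h1,
    ⟨β, hβ, hpos, rfl, fun s hs => ⟨?_, hsub s hs _⟩⟩, ?_⟩
  · exact isBoundedSeq_of_le_one (fun n => (Real.rpow_pos_of_pos (hpos n) s).le)
      (fun n => Real.rpow_le_one (hpos n).le (h1 n) hs.le)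
  · have := hsub 1 one_pos (by simpa using hβ)
    simpa using this

theorem generalizedMeanTransform_contractive_isMID_isSubnormal {α : ℕ → ℝ} (hpos : ∀ n, 0 < α n)
    (hα : IsBoundedSeq α) (hcm : IsCompletelyMonotone (1 - α)) {t : ℝ} (h0 : 0 ≤ t)
    (ht : t ≤ 1 / 2) :
    ‖generalizedMeanTransform (weightedShift α hα) t‖ ≤ 1 ∧
      IsMID (generalizedMeanTransform (weightedShift α hα) t) ∧
      IsSubnormal (generalizedMeanTransform (weightedShift α hα) t) := by
  have h1 : ∀ n, α n ≤ 1 := fun n => sub_nonneg.1 (hcm.nonneg n)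
  have hle : ∀ n (s : ℝ), 0 ≤ s → α n ^ s ≤ 1 := fun n s hs => Real.rpow_le_one (hpos n).le (h1 n) hs
  have hp : ∀ n (s : ℝ), 0 < α n ^ s := fun n s => Real.rpow_pos_of_pos (hpos n) s
  have hβ0 : ∀ n, 0 < (α (n + 1) ^ t * α n ^ (1 - t) + α (n + 1) ^ (1 - t) * α n ^ t) / 2 :=
    fun n => half_pos (add_pos (mul_pos (hp _ _) (hp _ _)) (mul_pos (hp _ _) (hp _ _)))
  have hβ1 : ∀ n, (α (n + 1) ^ t * α n ^ (1 - t) + α (n + 1) ^ (1 - t) * α n ^ t) / 2 ≤ 1 := by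
    intro n
    have := mul_le_one₀ (hle (n + 1) t h0) (hp n (1 - t)).le (hle n (1 - t) (by linarith))
    have := mul_le_one₀ (hle (n + 1) (1 - t) (by linarith)) (hp n t).le (hle n t h0)
    linarith
  rw [generalizedMeanTransform_weightedShift hα hpos h0 (by linarith)
    (isBoundedSeq_of_le_one (fun n => (hβ0 n).le) hβ1)]
  exact weightedShift_contractive_isMID_isSubnormal _ hβ0 hβ1
    fun s hs => hcm.prod_range_mean hpos h0 ht hs

end

theorem proposition3p7 (α : ℕ → ℝ) (hpos : ∀ n, 0 < α n) (hα : IsBoundedSeq α)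
    (hcontr : ‖weightedShift α hα‖ ≤ 1) :
    (IsCompletelyAlternating (fun n => α n ^ 2) →
      (∃ hβ : IsBoundedSeq (fun n => Real.sqrt ((α n ^ 2 + α (n + 1) ^ 2) / 2)),
        ‖weightedShift (fun n => Real.sqrt ((α n ^ 2 + α (n + 1) ^ 2) / 2)) hβ‖ ≤ 1 ∧
        IsMID (weightedShift (fun n => Real.sqrt ((α n ^ 2 + α (n + 1) ^ 2) / 2)) hβ) ∧
        IsSubnormal (weightedShift (fun n => Real.sqrt ((α n ^ 2 + α (n + 1) ^ 2) / 2)) hβ)) ∧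
      ∀ t : ℝ, 0 ≤ t → t ≤ 1 / 2 →
        ‖generalizedMeanTransform (weightedShift α hα) t‖ ≤ 1 ∧
        IsMID (generalizedMeanTransform (weightedShift α hα) t) ∧
        IsSubnormal (generalizedMeanTransform (weightedShift α hα) t)) ∧
    (IsCompletelyAlternating α →
      ∀ t : ℝ, 0 ≤ t → t ≤ 1 / 2 →
        ‖generalizedMeanTransform (weightedShift α hα) t‖ ≤ 1 ∧
        IsMID (generalizedMeanTransform (weightedShift α hα) t) ∧
        IsSubnormal (generalizedMeanTransform (weightedShift α hα) t)) := by
  have h1 := le_one_of_norm_weightedShift_le_one hα hcontr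
  refine ⟨fun hca => ?_, fun hca t h0 ht =>
    generalizedMeanTransform_contractive_isMID_isSubnormal hpos hα (hca.one_sub h1) h0 ht⟩
  have hsq1 : ∀ n, α n ^ 2 ≤ 1 := fun n => pow_le_one₀ (hpos n).le (h1 n)
  have hsq0 : ∀ n, 0 < α n ^ 2 := fun n => pow_pos (hpos n) 2
  have hcm := hca.one_sub hsq1
  refine ⟨?_, fun t h0 ht =>
    generalizedMeanTransform_contractive_isMID_isSubnormal hpos hα ?_ h0 ht⟩
  · have hu0 : ∀ n, 0 < (α n ^ 2 + α (n + 1) ^ 2) / 2 := fun n =>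
      half_pos (add_pos (hsq0 n) (hsq0 (n + 1)))
    have hβ1 : ∀ n, Real.sqrt ((α n ^ 2 + α (n + 1) ^ 2) / 2) ≤ 1 := fun n => by
      rw [Real.sqrt_le_left zero_le_one]
      linarith [hsq1 n, hsq1 (n + 1)]
    refine ⟨isBoundedSeq_of_le_one (fun n => Real.sqrt_nonneg _) hβ1,
      weightedShift_contractive_isMID_isSubnormal _ (fun n => Real.sqrt_pos.2 (hu0 n)) hβ1
        fun s hs => ?_⟩
    -- The squared new weights are averages of `α²` and its shift; the square root is absorbed into
    -- the exponent as `s / 2`.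
    have hu : IsCompletelyMonotone (1 - fun n => (α n ^ 2 + α (n + 1) ^ 2) / 2) := by
      convert (hcm.add hcm.shift).const_mul (c := 1 / 2) (by norm_num) using 1
      ext n
      simp only [Pi.sub_apply, Pi.add_apply, Pi.one_apply]
      ring
    convert hu.prod_range_rpow hu0 (s := 1 / 2 * s) (by positivity) using 1
    ext n
    refine Finset.prod_congr rfl fun i _ => ?_
    rw [Real.rpow_mul (hu0 i).le, Real.sqrt_eq_rpow]
  -- Since `α = (α²)^(1/2)`, the hypothesis on `α²` gives complete monotonicity of `1 - α`.
  · convert hcm.one_sub_rpow hsq0 (θ := 1 / 2) (by norm_num) (by norm_num) using 3 with n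
    rw [← Real.sqrt_eq_rpow, Real.sqrt_sq (hpos n).le]
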